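/- Let $\varepsilon>0$ and let $d$ be the Riemannian product distance on the cylinder $\mathbb{S}^1\times\,]0,\varepsilon[$ (with $\mathbb{S}^1=\mathbb{R}/2\pi\mathbb{Z}$), that is, $$d\big((\theta_1,z_1),(\theta_2,z_2)\big)=\big(d_{\mathbb{S}^1}(\theta_1,\theta_2)^2+|z_1-z_2|^2\big)^{1/2},$$ where $d_{\mathbb{S}^1}$ is the geodesic distance of the circle of length $2\pi$. Let $d'$ be any distance on the set $\mathbb{S}^1\times\,]0,\varepsilon[$ and let $E'$ denote the resulting metric space. For $h\in\,]0,\varepsilon[$ put $$\Delta(h):=\sup_{0<z_1,z_2\le h}\ \sup_{\theta_1,\theta_2\in\mathbb{S}^1}\big|d'\big((\theta_1,z_1),(\theta_2,z_2)\big)-d\big((\theta_1,z_1),(\theta_2,z_2)\big)\big|\in[0,+\infty],$$ and let $$\delta_{E'}:=\sup\{\delta>0:\ \Delta(h)=O(h^\delta)\text{ as }h\to0^+\}\in[-\infty,+\infty],$$ with the convention $\sup\emptyset=-\infty$. A symmetric function $f:S\times S\to\mathbb{R}$ on a set $S$ is a negative definite kernel if $\sum_{i,j=1}^n c_ic_jf(x_i,x_j)\le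 0$ for all $n$, all $x_1,\dots,x_n\in S$ and all $c_1,\dots,c_n\in\mathbb{R}$ with $\sum_{i=1}^n c_i=0$. The fractional index of $E'$ is $$\beta_{E'}:=\sup\{2H:\ H>0,\ (d')^{2H}\text{ is a negative definite kernel}\}\in[0,+\infty],$$ which is $0$ if there is no such $H$. If $\delta_{E'}$ is finite (in particular $\Delta(h)=O(h^\delta)$ for some $\delta>0$), then $$\beta_{E'}\le\frac{3}{\delta_{E'}+1},$$ and if $\delta_{E'}=+\infty$, then $\beta_{E'}=0$. -/

import Mathlib

open Filter Topology
open scoped ENNReal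

noncomputable section

/-- A negative definite kernel on `E`: a symmetric function `f` such that
`∑ i, ∑ j, c i * c j * f (x i) (x j) ≤ 0` for all points `x i` and all reals `c i` of sum `0`. -/
def IsNegDefKernel {E : Type*} (f : E → E → ℝ) : Prop :=
  (∀ x y, f x y = f y x) ∧
    ∀ (n : ℕ) (x : Fin n → E) (c : Fin n → ℝ), ∑ i, c i = 0 →
      ∑ i, ∑ j, c i * c j * f (x i) (x j) ≤ 0

/-- The fractional index of a metric space, in `[0, ∞]`: the supremum of the numbers `2 * H`,
`H > 0`, for which `d ^ (2 * H)` is a negative definite kernel (`0` if there are none). -/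
def fractionalIndex (E : Type*) [MetricSpace E] : ℝ≥0∞ :=
  ⨆ (H : ℝ) (_ : 0 < H) (_ : IsNegDefKernel fun x y : E => dist x y ^ (2 * H)),
    ENNReal.ofReal (2 * H)

/-- The set `S¹ × ]0, ε[`, where `S¹ = ℝ / 2πℤ`. It is a plain definition, so that it does not
inherit the metric of the product. -/
def Cylinder (ε : ℝ) : Type :=
  AddCircle (2 * Real.pi) × Set.Ioo (0 : ℝ) ε

namespace Cylinder

variable {ε : ℝ}

/-- The angular coordinate `θ` of a point of the cylinder. -/
def angle (P : Cylinder ε) : AddCircle (2 * Real.pi) := P.1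

/-- The height `z` of a point of the cylinder. -/
def height (P : Cylinder ε) : ℝ := (P.2 : ℝ)

/-- The Riemannian product distance `√(d_{S¹}(θ₁, θ₂)² + |z₁ - z₂|²)` of the cylinder. The distance
of `AddCircle (2 * π)` is the geodesic distance of the circle of length `2π`. -/
def flatDist (P Q : Cylinder ε) : ℝ :=
  Real.sqrt (dist P.angle Q.angle ^ 2 + |P.height - Q.height| ^ 2)

/-- `Δ(h)`: the supremum in `[0, ∞]` of `|d' - d|` over all pairs of points of height at most `h`,
where `d'` is the given metric on the cylinder and `d` is the product distance. -/
def deviation [MetricSpace (Cylinder ε)] (h : ℝ) : ℝ≥0∞ :=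
  ⨆ (P : Cylinder ε) (Q : Cylinder ε) (_ : P.height ≤ h) (_ : Q.height ≤ h),
    ENNReal.ofReal |dist P Q - flatDist P Q|

/-- `Δ(h) = O(h ^ δ)` as `h → 0⁺`. -/
def DeviationIsBigO (ε : ℝ) [MetricSpace (Cylinder ε)] (δ : ℝ) : Prop :=
  ∃ C : ℝ, ∀ᶠ h in 𝓝[>] (0 : ℝ), deviation (ε := ε) h ≤ ENNReal.ofReal (C * h ^ δ)

/-- The supremum in `[-∞, ∞]` of all `δ > 0` with `Δ(h) = O(h ^ δ)` as `h → 0⁺`;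
it is `-∞` if there is no such `δ`. -/
def decayExponent (ε : ℝ) [MetricSpace (Cylinder ε)] : EReal :=
  ⨆ (δ : ℝ) (_ : 0 < δ) (_ : DeviationIsBigO ε δ), (δ : EReal)

end Cylinder

end

/-! Write `β = 2 * H`. Negative definiteness of `d' ^ β` is tested on `4 * n` points: heights `τ, …,
n * τ` on the meridians `0, τ, π, π + τ`, with weights `1, -1, 1, -1`. For the flat distance, each
pair of heights gains at least `c * τ` from antipodal meridians, because the circle distance falls
linearly away from the antipode (`rpow_antipodal_gain`). Neighbouring meridians cost at most `τ ^ β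
* 2 / (i + 1)` at height difference `i * τ` (`rpow_sq_add_sq_sub_le`), in total of order `n * τ ^ β
* log n`. So the gain `n ^ 2 * τ` wins once `n * τ ^ (1 - β)` beats `log n`. Replacing `d` by `d'`
costs of order `n ^ 2 * (n * τ) ^ δ * τ ^ (β - 1)`. If `β * (δ + 1) > 3`, taking `τ` to be a
suitable power of `n` makes both losses negligible, a contradiction (`grid_inequality`,
`exponent_mul_le`). The bound `β ≤ 1` used along the way comes from four points on shrinking circles
(`exponent_le_one`). -/

/-! ### Inequalities for real powers -/

/-- A concave power lies below its tangent lines. -/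
theorem rpow_le_tangent {A B s : ℝ} (hA : 0 ≤ A) (hB : 0 < B) (hs0 : 0 ≤ s) (hs1 : s ≤ 1) :
    A ^ s ≤ B ^ s + s * B ^ (s - 1) * (A - B) := by
  have h := rpow_one_add_le_one_add_mul_self (s := (A - B) / B) (p := s)
    (by rw [le_div_iff₀ hB]; linarith) hs0 hs1
  have e : 1 + (A - B) / B = A / B := by field_simp; ring
  rw [e, Real.div_rpow hA hB.le, div_le_iff₀ (Real.rpow_pos_of_pos hB s)] at h
  rw [Real.rpow_sub_one hB.ne']
  refine h.trans (le_of_eq ?_)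
  field_simp

/-- By homogeneity `a = 1`, and there `x ^ β` lies between `x` and `1`. This turns an error on
distances into an error on their powers. -/
theorem abs_rpow_sub_rpow_le {a b β : ℝ} (ha : 0 < a) (hb : 0 ≤ b) (hβ0 : 0 ≤ β) (hβ1 : β ≤ 1) :
    |b ^ β - a ^ β| ≤ |b - a| * a ^ (β - 1) := by
  have hx : 0 ≤ b / a := div_nonneg hb ha.le
  have key : |(b / a) ^ β - 1| ≤ |b / a - 1| := by
    rcases le_total (b / a) 1 with h | h
    · rw [abs_of_nonpos (by linarith [Real.rpow_le_one hx h hβ0]),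
        abs_of_nonpos (by linarith)]
      linarith [Real.self_le_rpow_of_le_one hx h hβ1]
    · rw [abs_of_nonneg (by linarith [Real.one_le_rpow h hβ0]),
        abs_of_nonneg (by linarith)]
      linarith [Real.rpow_le_self_of_one_le h hβ1]
  have hp := Real.rpow_pos_of_pos ha β
  calc |b ^ β - a ^ β| = |(b / a) ^ β - 1| * a ^ β := by
        rw [Real.div_rpow hb ha.le, ← abs_of_pos hp, ← abs_mul, abs_of_pos hp, sub_mul,
          div_mul_cancel₀ _ hp.ne', one_mul]
    _ ≤ |b / a - 1| * a ^ β := by gcongr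
    _ = |b - a| * a ^ (β - 1) := by
        rw [Real.rpow_sub_one ha.ne', div_sub_one ha.ne', abs_div, abs_of_pos ha]
        ring

theorem sqrt_rpow (x β : ℝ) (hx : 0 ≤ x) : Real.sqrt x ^ β = x ^ (β / 2) := by
  rw [Real.sqrt_eq_rpow, ← Real.rpow_mul hx]
  ring_nf

/-- For `i ≥ 1` the tangent at `(i * τ) ^ 2` gives a bound of order `τ ^ β * i ^ (β - 2)`, and `β ≤
1` makes it harmonic. The form `2 / (i + 1)` also covers `i = 0`. -/
theorem rpow_sq_add_sq_sub_le {τ β : ℝ} (hτ : 0 < τ) (hβ0 : 0 < β) (hβ1 : β ≤ 1) (i : ℕ) :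
    (τ ^ 2 + (i * τ) ^ 2) ^ (β / 2) - ((0 : ℝ) ^ 2 + (i * τ) ^ 2) ^ (β / 2)
      ≤ τ ^ β * (2 / (i + 1)) := by
  rcases Nat.eq_zero_or_pos i with rfl | hi
  · have h1 : (τ ^ 2) ^ (β / 2) = τ ^ β := by
      rw [← Real.rpow_natCast, ← Real.rpow_mul hτ.le]
      congr 1
      push_cast
      ring
    have h2 := Real.rpow_pos_of_pos hτ β
    simp [h1, Real.zero_rpow (show β / 2 ≠ 0 by positivity)]
    linarith
  · have hi1 : (1 : ℝ) ≤ i := by exact_mod_cast hi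
    have hiτ : 0 < (i : ℝ) * τ := by positivity
    have h := rpow_le_tangent (A := τ ^ 2 + (i * τ) ^ 2) (B := (i * τ) ^ 2) (s := β / 2)
      (by positivity) (by positivity) (by linarith) (by linarith)
    have e : (((i : ℝ) * τ) ^ 2) ^ (β / 2 - 1) = (i : ℝ) ^ (β - 2) * τ ^ β / τ ^ 2 := by
      rw [← Real.rpow_natCast ((i : ℝ) * τ), ← Real.rpow_mul hiτ.le,
        Real.mul_rpow (by positivity) hτ.le, show ((2 : ℕ) : ℝ) * (β / 2 - 1) = β - 2 by
          push_cast; ring, mul_div_assoc, ← Real.rpow_natCast τ, ← Real.rpow_sub hτ]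
      norm_num
    have h3 : (i : ℝ) ^ (β - 2) ≤ 1 / i := by
      rw [one_div, ← Real.rpow_neg_one]
      exact Real.rpow_le_rpow_of_exponent_le hi1 (by linarith)
    have h4 : (1 : ℝ) / i ≤ 2 / (i + 1) := by
      rw [div_le_div_iff₀ (by positivity) (by positivity)]
      linarith
    have hp : 0 < τ ^ β := Real.rpow_pos_of_pos hτ β
    have hip : 0 < (i : ℝ) ^ (β - 2) := Real.rpow_pos_of_pos (by positivity) _
    rw [e, add_sub_cancel_right, mul_assoc, div_mul_cancel₀ _ (by positivity)] at h
    rw [zero_pow two_ne_zero, zero_add]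
    have h5 : β / 2 * ((i : ℝ) ^ (β - 2) * τ ^ β) ≤ 1 * ((i : ℝ) ^ (β - 2) * τ ^ β) := by
      gcongr
      linarith
    have h6 : (i : ℝ) ^ (β - 2) * τ ^ β ≤ 2 / (i + 1) * τ ^ β := by
      gcongr
      exact h3.trans h4
    linarith

/-- Tangent at `π ^ 2 + z ^ 2`: the square drops by `2 * π * τ - τ ^ 2 ≥ τ`, and the slope is
smallest at `|z| = 1`. -/
theorem rpow_antipodal_gain {τ β z : ℝ} (hτ : 0 < τ) (hτ1 : τ ≤ 1) (hβ0 : 0 < β) (hβ1 : β ≤ 1)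
    (hz : |z| ≤ 1) :
    β / 2 * (Real.pi ^ 2 + 1) ^ (β / 2 - 1) * τ
      ≤ (Real.pi ^ 2 + z ^ 2) ^ (β / 2) - ((Real.pi - τ) ^ 2 + z ^ 2) ^ (β / 2) := by
  have hpi := Real.pi_gt_three
  have hz2 : z ^ 2 ≤ 1 := by rw [← sq_abs]; nlinarith [abs_nonneg z]
  have h := rpow_le_tangent (A := (Real.pi - τ) ^ 2 + z ^ 2) (B := Real.pi ^ 2 + z ^ 2)
    (s := β / 2) (by positivity) (by positivity) (by linarith) (by linarith)
  have h1 : (Real.pi ^ 2 + 1) ^ (β / 2 - 1) ≤ (Real.pi ^ 2 + z ^ 2) ^ (β / 2 - 1) :=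
    Real.rpow_le_rpow_of_nonpos (by positivity) (by linarith) (by linarith)
  have h2 : τ ≤ (Real.pi ^ 2 + z ^ 2) - ((Real.pi - τ) ^ 2 + z ^ 2) := by nlinarith
  have h3 : β / 2 * (Real.pi ^ 2 + 1) ^ (β / 2 - 1) * τ ≤
      β / 2 * (Real.pi ^ 2 + z ^ 2) ^ (β / 2 - 1) *
        ((Real.pi ^ 2 + z ^ 2) - ((Real.pi - τ) ^ 2 + z ^ 2)) := by
    gcongr
  linarith

/-! ### Sums over a grid -/

/-- Each distance `i` from `j` is attained at most twice, at `j + i` and `j - i`. -/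
theorem sum_fin_dist_le {g : ℕ → ℝ} (hg : ∀ i, 0 ≤ g i) (n : ℕ) (j : Fin n) :
    ∑ l : Fin n, g (Nat.dist j l) ≤ 2 * ∑ i ∈ Finset.range n, g i := by
  have h1 : ∀ l : Fin n, g (Nat.dist j l) ≤ ∑ i ∈ Finset.range n,
      ((if (l : ℕ) = j + i then g i else 0) + (if (j : ℕ) = l + i then g i else 0)) := by
    intro l
    have hd : Nat.dist j l ∈ Finset.range n := by
      have := j.2
      have := l.2
      simp only [Nat.dist, Finset.mem_range]
      omega
    refine le_trans ?_ (Finset.single_le_sum (fun i _ => ?_) hd)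
    · rcases le_total (j : ℕ) l with h | h
      · rw [if_pos (by simp only [Nat.dist]; omega)]
        exact le_add_of_nonneg_right (by split_ifs <;> simp [hg])
      · rw [if_pos (show (j : ℕ) = l + Nat.dist j l by simp only [Nat.dist]; omega)]
        exact le_add_of_nonneg_left (by split_ifs <;> simp [hg])
    · exact add_nonneg (by split_ifs <;> simp [hg]) (by split_ifs <;> simp [hg])
  refine (Finset.sum_le_sum fun l _ => h1 l).trans ?_
  rw [Finset.sum_comm, Finset.mul_sum]
  refine Finset.sum_le_sum fun i _ => ?_
  rw [Finset.sum_add_distrib, two_mul]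
  have aux : ∀ (p : Fin n → Prop) [DecidablePred p], (∀ a b, p a → p b → a = b) →
      ∑ l, (if p l then g i else 0) ≤ g i := by
    intro p _ hp
    rw [Finset.sum_ite, Finset.sum_const_zero, add_zero, Finset.sum_const, nsmul_eq_mul]
    refine mul_le_of_le_one_left (hg i) ?_
    exact_mod_cast Finset.card_le_one.2 fun a ha b hb =>
      hp a b (Finset.mem_filter.1 ha).2 (Finset.mem_filter.1 hb).2
  exact add_le_add (aux _ fun a b ha hb => Fin.ext (by omega))
    (aux _ fun a b ha hb => Fin.ext (by omega))

theorem sum_two_div_dist_le (n : ℕ) (j : Fin n) :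
    ∑ l : Fin n, (2 : ℝ) / ((Nat.dist j l : ℕ) + 1) ≤ 4 * (1 + Real.log n) := by
  have h := sum_fin_dist_le (g := fun i => (2 : ℝ) / (i + 1)) (fun i => by positivity) n j
  refine h.trans ?_
  have h2 := harmonic_le_one_add_log n
  have h3 : ∑ i ∈ Finset.range n, (2 : ℝ) / (i + 1) = 2 * (harmonic n : ℝ) := by
    rw [harmonic, Rat.cast_sum, Finset.mul_sum]
    refine Finset.sum_congr rfl fun i _ => ?_
    push_cast
    rw [div_eq_mul_inv]
  rw [h3]
  linarith

theorem IsNegDefKernel.sum_nonpos {E ι : Type*} [Fintype ι] {f : E → E → ℝ}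
    (hf : IsNegDefKernel f) (x : ι → E) (c : ι → ℝ) (hc : ∑ i, c i = 0) :
    ∑ i, ∑ j, c i * c j * f (x i) (x j) ≤ 0 := by
  let e := (Fintype.equivFin ι).symm
  have h := hf.2 _ (x ∘ e) (c ∘ e) (by
    simpa using (Equiv.sum_comp e c).trans hc)
  refine le_of_eq_of_le ?_ h
  rw [← Equiv.sum_comp e]
  refine Finset.sum_congr rfl fun i _ => ?_
  rw [← Equiv.sum_comp e]
  rfl

/-! ### Two pairs of antipodal meridians -/

namespace Cylinder

variable {ε : ℝ}

/-- The angles `0`, `τ` and their antipodes. -/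
noncomputable def meridian (τ : ℝ) : Fin 4 → ℝ := ![0, τ, Real.pi, Real.pi + τ]

/-- Alternating weights on the four meridians. -/
def meridianWeight : Fin 4 → ℝ := ![1, -1, 1, -1]

/-- The points of heights `z j` on the four meridians. -/
noncomputable def gridPoint {n : ℕ} (τ : ℝ) (z : Fin n → Set.Ioo (0 : ℝ) ε) (p : Fin n × Fin 4) :
    Cylinder ε :=
  (((meridian τ p.2 : ℝ) : AddCircle (2 * Real.pi)), z p.1)

theorem dist_coe_of_abs_le {x y : ℝ} (h : |x - y| ≤ Real.pi) :
    dist (x : AddCircle (2 * Real.pi)) (y : AddCircle (2 * Real.pi)) = |x - y| := by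
  rw [dist_eq_norm, ← AddCircle.coe_sub]
  refine (AddCircle.norm_coe_eq_abs_iff _ (by positivity)).2 ?_
  rw [abs_of_pos (by positivity : (0 : ℝ) < 2 * Real.pi)]
  linarith

theorem dist_meridian {τ : ℝ} (hτ : 0 < τ) (hτπ : τ < Real.pi) (a b : Fin 4) :
    dist (meridian τ a : AddCircle (2 * Real.pi)) (meridian τ b : AddCircle (2 * Real.pi)) =
      (![![0, τ, Real.pi, Real.pi - τ], ![τ, 0, Real.pi - τ, Real.pi],
        ![Real.pi, Real.pi - τ, 0, τ], ![Real.pi - τ, Real.pi, τ, 0]] : Fin 4 → Fin 4 → ℝ) a b := by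
  have hw : dist ((0 : ℝ) : AddCircle (2 * Real.pi)) ((Real.pi + τ : ℝ) : AddCircle (2 * Real.pi))
      = Real.pi - τ := by
    -- The short arc goes the other way round, so `0` is lifted to `2 * π`.
    rw [← AddCircle.coe_add_period (2 * Real.pi) 0, dist_coe_of_abs_le]
    · rw [abs_of_pos] <;> linarith
    · rw [abs_of_pos] <;> linarith
  have hd : ∀ {x y r : ℝ}, x - y = r ∨ y - x = r → 0 ≤ r → r ≤ Real.pi →
      dist (x : AddCircle (2 * Real.pi)) (y : AddCircle (2 * Real.pi)) = r := by
    intro x y r h h0 h1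
    have h2 : |x - y| = r := by
      rcases h with h | h
      · rw [h, abs_of_nonneg h0]
      · rw [abs_sub_comm, h, abs_of_nonneg h0]
    rw [dist_coe_of_abs_le (h2.trans_le h1), h2]
  fin_cases a <;> fin_cases b <;> simp only [meridian] <;>
    first
    | exact hw
    | exact (dist_comm _ _).trans hw
    | refine hd (Or.inl ?_) ?_ ?_ <;> simp <;> linarith
    | refine hd (Or.inr ?_) ?_ ?_ <;> simp <;> linarith

theorem sum_meridianWeight {τ : ℝ} (hτ : 0 < τ) (hτπ : τ < Real.pi) (g : ℝ → ℝ) :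
    ∑ a, ∑ b, meridianWeight a * meridianWeight b *
      g (dist (meridian τ a : AddCircle (2 * Real.pi)) (meridian τ b : AddCircle (2 * Real.pi))) =
      4 * (g 0 - g τ + (g Real.pi - g (Real.pi - τ))) := by
  simp only [dist_meridian hτ hτπ, Fin.sum_univ_four, meridianWeight]
  simp
  ring

theorem flatDist_gridPoint {n : ℕ} (τ : ℝ) (z : Fin n → Set.Ioo (0 : ℝ) ε) (j l : Fin n)
    (a b : Fin 4) :
    flatDist (gridPoint τ z (j, a)) (gridPoint τ z (l, b)) =
      Real.sqrt (dist (meridian τ a : AddCircle (2 * Real.pi))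
        (meridian τ b : AddCircle (2 * Real.pi)) ^ 2 + ((z j : ℝ) - z l) ^ 2) := by
  rw [← sq_abs ((z j : ℝ) - z l)]
  rfl

theorem sum_flatDist_gridPoint {n : ℕ} {τ : ℝ} (hτ : 0 < τ) (hτπ : τ < Real.pi)
    (z : Fin n → Set.Ioo (0 : ℝ) ε) (β : ℝ) :
    ∑ p, ∑ q, meridianWeight p.2 * meridianWeight q.2 *
        flatDist (gridPoint τ z p) (gridPoint τ z q) ^ β =
      ∑ j, ∑ l, 4 * ((((0 : ℝ) ^ 2 + ((z j : ℝ) - z l) ^ 2) ^ (β / 2)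
          - (τ ^ 2 + ((z j : ℝ) - z l) ^ 2) ^ (β / 2))
        + ((Real.pi ^ 2 + ((z j : ℝ) - z l) ^ 2) ^ (β / 2)
          - ((Real.pi - τ) ^ 2 + ((z j : ℝ) - z l) ^ 2) ^ (β / 2))) := by
  rw [Fintype.sum_prod_type]
  refine Finset.sum_congr rfl fun j _ => ?_
  simp only [Fintype.sum_prod_type]
  rw [Finset.sum_comm]
  refine Finset.sum_congr rfl fun l _ => ?_
  rw [← sum_meridianWeight hτ hτπ fun t => (t ^ 2 + ((z j : ℝ) - z l) ^ 2) ^ (β / 2)]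
  simp only [flatDist_gridPoint]
  refine Finset.sum_congr rfl fun a _ => Finset.sum_congr rfl fun b _ => ?_
  rw [sqrt_rpow _ _ (by positivity)]

theorem sum_meridianWeight_eq_zero (n : ℕ) :
    ∑ p : Fin n × Fin 4, meridianWeight p.2 = 0 := by
  rw [Fintype.sum_prod_type]
  simp [meridianWeight, Fin.sum_univ_four]

theorem abs_meridianWeight (a : Fin 4) : |meridianWeight a| = 1 := by
  fin_cases a <;> simp [meridianWeight]

/-! ### Bounds on the exponent -/

theorem DeviationIsBigO.exists_bound [MetricSpace (Cylinder ε)] {δ : ℝ}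
    (h : DeviationIsBigO ε δ) : ∃ C : ℝ, 0 ≤ C ∧ ∀ᶠ h in 𝓝[>] (0 : ℝ), ∀ P Q : Cylinder ε,
      P.height ≤ h → Q.height ≤ h → |dist P Q - flatDist P Q| ≤ C * h ^ δ := by
  obtain ⟨C, hC⟩ := h
  refine ⟨|C|, abs_nonneg C, ?_⟩
  filter_upwards [hC, self_mem_nhdsWithin] with h hh h0 P Q hP hQ
  have hpos : 0 < h ^ δ := Real.rpow_pos_of_pos h0 δ
  have h1 : ENNReal.ofReal |dist P Q - flatDist P Q| ≤ ENNReal.ofReal (|C| * h ^ δ) :=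
    calc ENNReal.ofReal |dist P Q - flatDist P Q| ≤ deviation (ε := ε) h :=
          le_iSup_of_le P (le_iSup_of_le Q (le_iSup_of_le hP (le_iSup_of_le hQ le_rfl)))
      _ ≤ ENNReal.ofReal (C * h ^ δ) := hh
      _ ≤ ENNReal.ofReal (|C| * h ^ δ) := by gcongr; exact le_abs_self C
  exact (ENNReal.ofReal_le_ofReal_iff (by positivity)).1 h1

/-- Circles have fractional index at most `1`, and this passes to the limit `h → 0⁺`. -/
theorem exponent_le_one (hε : 0 < ε) [MetricSpace (Cylinder ε)] {δ β : ℝ} (hδ : 0 < δ)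
    (hβ : 0 < β) (hdev : DeviationIsBigO ε δ)
    (hneg : IsNegDefKernel fun P Q : Cylinder ε => dist P Q ^ β) : β ≤ 1 := by
  obtain ⟨C, hC, hev⟩ := hdev.exists_bound
  have hpi := Real.pi_pos
  -- The four meridians become the vertices of a square, whose inequality reads `2 ^ β ≤ 2`.
  let τ := Real.pi / 2
  have hτ : 0 < τ := by positivity
  have hτπ : τ < Real.pi := half_lt_self hpi
  let z : ℝ → Fin 1 → Set.Ioo (0 : ℝ) ε := fun h _ =>
    if hh : h ∈ Set.Ioo (0 : ℝ) ε then ⟨h, hh⟩ else ⟨ε / 2, by constructor <;> linarith⟩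
  have hmem : ∀ᶠ h in 𝓝[>] (0 : ℝ), h ∈ Set.Ioo (0 : ℝ) ε := Ioo_mem_nhdsGT hε
  have hlim : ∀ p q : Fin 1 × Fin 4,
      Tendsto (fun h => dist (gridPoint τ (z h) p) (gridPoint τ (z h) q)) (𝓝[>] 0)
        (𝓝 (dist (meridian τ p.2 : AddCircle (2 * Real.pi))
          (meridian τ q.2 : AddCircle (2 * Real.pi)))) := by
    intro p q
    have h0 : Tendsto (fun h : ℝ => C * h ^ δ) (𝓝[>] 0) (𝓝 0) := by
      have h1 := ((Real.continuous_rpow_const hδ.le).tendsto 0).const_mul C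
      rw [Real.zero_rpow hδ.ne', mul_zero] at h1
      exact h1.mono_left nhdsWithin_le_nhds
    rw [tendsto_iff_dist_tendsto_zero]
    refine squeeze_zero' (Eventually.of_forall fun _ => dist_nonneg) ?_ h0
    filter_upwards [hev, hmem] with h hh hm
    have hz : ∀ i, (z h i : ℝ) = h := fun i => by simp only [z, dif_pos hm]
    have h2 := hh (gridPoint τ (z h) p) (gridPoint τ (z h) q) (hz p.1).le (hz q.1).le
    have h3 : flatDist (gridPoint τ (z h) p) (gridPoint τ (z h) q) =
        dist (meridian τ p.2 : AddCircle (2 * Real.pi))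
          (meridian τ q.2 : AddCircle (2 * Real.pi)) := by
      obtain ⟨j, a⟩ := p
      obtain ⟨l, b⟩ := q
      rw [flatDist_gridPoint, Subsingleton.elim j l, sub_self, zero_pow two_ne_zero, add_zero,
        Real.sqrt_sq dist_nonneg]
    rwa [h3] at h2
  have hsum := le_of_tendsto' (tendsto_finsetSum (Finset.univ : Finset (Fin 1 × Fin 4)) fun p _ =>
    tendsto_finsetSum (Finset.univ : Finset (Fin 1 × Fin 4)) fun q _ =>
      ((hlim p q).rpow_const (Or.inr hβ.le)).const_mul
        (meridianWeight p.2 * meridianWeight q.2)) fun h =>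
      hneg.sum_nonpos (gridPoint τ (z h)) (fun p => meridianWeight p.2)
        (sum_meridianWeight_eq_zero 1)
  simp only [Fintype.sum_prod_type, Finset.univ_unique, Finset.sum_singleton] at hsum
  rw [sum_meridianWeight hτ hτπ (fun t => t ^ β), Real.zero_rpow hβ.ne'] at hsum
  have h4 : Real.pi ^ β = 2 ^ β * τ ^ β := by
    rw [← Real.mul_rpow (by norm_num) hτ.le]
    congr 1
    simp only [τ]
    ring
  have h5 : Real.pi - τ = τ := by simp only [τ]; ring
  rw [h5, h4] at hsum
  have hp := Real.rpow_pos_of_pos hτ β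
  have h6 : (2 : ℝ) ^ β ≤ 2 ^ (1 : ℝ) := by
    rw [Real.rpow_one]
    by_contra! hlt
    nlinarith
  exact (Real.rpow_le_rpow_left_iff one_lt_two).1 h6

theorem le_flatDist_gridPoint {n : ℕ} {τ : ℝ} (hτ : 0 < τ) (hτ1 : τ ≤ 1)
    (z : Fin n → Set.Ioo (0 : ℝ) ε) (hz : ∀ j l, j ≠ l → τ ≤ |(z j : ℝ) - z l|)
    {p q : Fin n × Fin 4} (hpq : p ≠ q) :
    τ ≤ flatDist (gridPoint τ z p) (gridPoint τ z q) := by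
  have hpi := Real.pi_gt_three
  obtain ⟨j, a⟩ := p
  obtain ⟨l, b⟩ := q
  rw [flatDist_gridPoint]
  apply Real.le_sqrt_of_sq_le
  by_cases hjl : j = l
  · have hab : a ≠ b := fun h => hpq (by rw [hjl, h])
    have h1 : τ ≤ dist (meridian τ a : AddCircle (2 * Real.pi))
        (meridian τ b : AddCircle (2 * Real.pi)) := by
      rw [dist_meridian hτ (by linarith)]
      revert hab
      fin_cases a <;> fin_cases b <;> simp <;> linarith
    nlinarith [sq_nonneg ((z j : ℝ) - z l)]
  · have h1 := hz j l hjl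
    rw [← sq_abs ((z j : ℝ) - z l)]
    nlinarith [sq_nonneg (dist (meridian τ a : AddCircle (2 * Real.pi))
        (meridian τ b : AddCircle (2 * Real.pi)))]

theorem flatDist_self (P : Cylinder ε) : flatDist P P = 0 := by
  simp [flatDist]

/-- The inequality obtained by testing negative definiteness on `4 * n` points of heights
`τ, 2 * τ, …, n * τ`. -/
theorem grid_inequality [MetricSpace (Cylinder ε)] {β τ η : ℝ} {n : ℕ}
    (hβ0 : 0 < β) (hβ1 : β ≤ 1) (hτ : 0 < τ) (hτ1 : τ ≤ 1) (hn : 0 < n)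
    (hnτ1 : n * τ ≤ 1) (hnτε : n * τ < ε)
    (hη : ∀ P Q : Cylinder ε, P.height ≤ n * τ → Q.height ≤ n * τ →
      |dist P Q - flatDist P Q| ≤ η)
    (hneg : IsNegDefKernel fun P Q : Cylinder ε => dist P Q ^ β) :
    n ^ 2 * (β / 2 * (Real.pi ^ 2 + 1) ^ (β / 2 - 1) * τ) ≤
      n * (τ ^ β * (4 * (1 + Real.log n))) + 4 * n ^ 2 * (η * τ ^ (β - 1)) := by
  have hpi := Real.pi_gt_three
  have hle : ∀ j : Fin n, ((j : ℕ) + 1 : ℝ) * τ ≤ n * τ := fun j => by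
    gcongr
    exact_mod_cast j.2
  -- The shift `j + 1` keeps the lowest height positive.
  let z : Fin n → Set.Ioo (0 : ℝ) ε := fun j =>
    ⟨((j : ℕ) + 1 : ℝ) * τ, by positivity, (hle j).trans_lt hnτε⟩
  have hzd : ∀ j l, |(z j : ℝ) - z l| = (Nat.dist j l : ℕ) * τ := by
    intro j l
    have e : (z j : ℝ) - z l = ((j : ℕ) - (l : ℕ) : ℝ) * τ := by simp only [z]; ring
    rw [e, abs_mul, abs_of_pos hτ]
    congr 1
    rcases le_total (j : ℕ) l with h | h
    · have h' : ((j : ℕ) : ℝ) ≤ (l : ℕ) := by exact_mod_cast h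
      rw [Nat.dist_eq_sub_of_le h, Nat.cast_sub h, abs_of_nonpos (by linarith)]
      ring
    · have h' : ((l : ℕ) : ℝ) ≤ (j : ℕ) := by exact_mod_cast h
      rw [Nat.dist_eq_sub_of_le_right h, Nat.cast_sub h, abs_of_nonneg (by linarith)]
  have hz1 : ∀ j l, |(z j : ℝ) - z l| ≤ 1 := fun j l => by
    refine le_trans ?_ hnτ1
    rw [hzd]
    gcongr
    have := j.2
    have := l.2
    simp only [Nat.dist]
    omega
  have hzsep : ∀ j l, j ≠ l → τ ≤ |(z j : ℝ) - z l| := fun j l hjl => by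
    rw [hzd]
    refine le_mul_of_one_le_left hτ.le ?_
    have : (j : ℕ) ≠ l := fun h => hjl (Fin.ext h)
    exact_mod_cast (show 1 ≤ Nat.dist j l by simp only [Nat.dist]; omega)
  have hzh : ∀ p, (gridPoint τ z p).height ≤ n * τ := fun p => hle p.1
  have hη0 : 0 ≤ η := by
    have p : Fin n × Fin 4 := (⟨0, hn⟩, 0)
    exact (abs_nonneg _).trans (hη _ _ (hzh p) (hzh p))
  have hpair : ∀ p q : Fin n × Fin 4, meridianWeight p.2 * meridianWeight q.2 *
        flatDist (gridPoint τ z p) (gridPoint τ z q) ^ β - η * τ ^ (β - 1) ≤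
      meridianWeight p.2 * meridianWeight q.2 *
        dist (gridPoint τ z p) (gridPoint τ z q) ^ β := by
    intro p q
    have hd : |dist (gridPoint τ z p) (gridPoint τ z q) ^ β -
        flatDist (gridPoint τ z p) (gridPoint τ z q) ^ β| ≤ η * τ ^ (β - 1) := by
      by_cases hpq : p = q
      · rw [hpq, dist_self, flatDist_self, sub_self, abs_zero]
        positivity
      -- Distinct grid points are at least `τ` apart, and `β - 1 ≤ 0`.
      · have h1 := le_flatDist_gridPoint hτ hτ1 z hzsep hpq
        refine (abs_rpow_sub_rpow_le (hτ.trans_le h1) dist_nonneg hβ0.le hβ1).trans ?_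
        exact mul_le_mul (hη _ _ (hzh p) (hzh q))
          (Real.rpow_le_rpow_of_nonpos hτ h1 (by linarith))
          (Real.rpow_nonneg (hτ.le.trans h1) _) hη0
    have hw : |meridianWeight p.2 * meridianWeight q.2 *
        (dist (gridPoint τ z p) (gridPoint τ z q) ^ β -
        flatDist (gridPoint τ z p) (gridPoint τ z q) ^ β)| ≤ η * τ ^ (β - 1) := by
      rwa [abs_mul, abs_mul, abs_meridianWeight, abs_meridianWeight, one_mul, one_mul]
    have := (abs_le.1 hw).1
    linarith
  have hsum := hneg.sum_nonpos (gridPoint τ z) (fun p => meridianWeight p.2)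
    (sum_meridianWeight_eq_zero n)
  have h1 := (Finset.sum_le_sum fun p (_ : p ∈ Finset.univ) =>
    Finset.sum_le_sum fun q (_ : q ∈ Finset.univ) => hpair p q).trans hsum
  simp only [Finset.sum_sub_distrib, Finset.sum_const, Finset.card_univ, Fintype.card_prod,
    Fintype.card_fin, nsmul_eq_mul] at h1
  rw [sum_flatDist_gridPoint hτ (by linarith)] at h1
  obtain ⟨c, hc⟩ : ∃ c, c = β / 2 * (Real.pi ^ 2 + 1) ^ (β / 2 - 1) * τ := ⟨_, rfl⟩
  rw [← hc]
  have h2 : ∀ j l : Fin n, 4 * (c - τ ^ β * (2 / ((Nat.dist j l : ℕ) + 1))) ≤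
      4 * ((((0 : ℝ) ^ 2 + ((z j : ℝ) - z l) ^ 2) ^ (β / 2)
          - (τ ^ 2 + ((z j : ℝ) - z l) ^ 2) ^ (β / 2))
        + ((Real.pi ^ 2 + ((z j : ℝ) - z l) ^ 2) ^ (β / 2)
          - ((Real.pi - τ) ^ 2 + ((z j : ℝ) - z l) ^ 2) ^ (β / 2))) := by
    intro j l
    have h3 := rpow_antipodal_gain hτ hτ1 hβ0 hβ1 (hz1 j l)
    rw [← hc] at h3
    have h4 := rpow_sq_add_sq_sub_le hτ hβ0 hβ1 (Nat.dist j l)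
    rw [← hzd, sq_abs] at h4
    linarith
  have h5 : 4 * (n ^ 2 * c - n * (τ ^ β * (4 * (1 + Real.log n)))) ≤
      ∑ j : Fin n, ∑ l : Fin n, 4 * (c - τ ^ β * (2 / ((Nat.dist j l : ℕ) + 1))) := by
    have h6 : ∀ j : Fin n, 4 * (n * c - τ ^ β * (4 * (1 + Real.log n))) ≤
        ∑ l : Fin n, 4 * (c - τ ^ β * (2 / ((Nat.dist j l : ℕ) + 1))) := by
      intro j
      rw [← Finset.mul_sum, Finset.sum_sub_distrib, ← Finset.mul_sum, Finset.sum_const,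
        Finset.card_univ, Fintype.card_fin, nsmul_eq_mul]
      gcongr
      exact sum_two_div_dist_le n j
    refine le_trans (le_of_eq ?_) (Finset.sum_le_sum fun j _ => h6 j)
    rw [Finset.sum_const, Finset.card_univ, Fintype.card_fin, nsmul_eq_mul]
    ring
  have h7 := h5.trans (Finset.sum_le_sum fun j _ => Finset.sum_le_sum fun l _ => h2 j l)
  push_cast at h1
  nlinarith

theorem exponent_mul_le (hε : 0 < ε) [MetricSpace (Cylinder ε)] {δ β : ℝ} (hδ : 0 < δ)
    (hβ : 0 < β) (hdev : DeviationIsBigO ε δ)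
    (hneg : IsNegDefKernel fun P Q : Cylinder ε => dist P Q ^ β) : β * (δ + 1) ≤ 3 := by
  have hβ1 := exponent_le_one hε hδ hβ hdev hneg
  obtain ⟨C, hC, hev⟩ := hdev.exists_bound
  by_contra! hlt
  have hden : 0 < 3 - 2 * β := by linarith
  -- With `τ = n ^ (-γ)`, `κ > 0` kills the neighbour loss and `σ > 0` the deviation. The first
  -- needs `γ * (1 - β) < 1`; this `γ` satisfies it, stays finite at `β = 1`, and gives `σ > 0` when
  -- `β * (δ + 1) > 3`.
  set γ := 3 / (3 - 2 * β) with hγ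
  have hγ1 : 0 < γ - 1 := by
    rw [hγ, div_sub_one hden.ne']
    apply div_pos <;> linarith
  set κ := 1 - γ * (1 - β) with hκ
  have hκ0 : 0 < κ := by
    have : κ = β / (3 - 2 * β) := by
      rw [hκ, hγ]
      field_simp
      ring
    rw [this]
    positivity
  set σ := (γ - 1) * δ - γ * (2 - β) with hσ
  have hσ0 : 0 < σ := by
    have : σ = (β * (2 * δ + 3) - 6) / (3 - 2 * β) := by
      rw [hσ, hγ]
      field_simp
      ring
    rw [this]
    apply div_pos _ hden
    nlinarith
  set c := β / 2 * (Real.pi ^ 2 + 1) ^ (β / 2 - 1) with hc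
  have hc0 : 0 < c := by positivity
  -- This is the top height `n * τ`.
  have hh : Tendsto (fun n : ℕ => (n : ℝ) ^ (-(γ - 1))) atTop (𝓝 0) :=
    (tendsto_rpow_neg_atTop hγ1).comp tendsto_natCast_atTop_atTop
  have hh' : Tendsto (fun n : ℕ => (n : ℝ) ^ (-(γ - 1))) atTop (𝓝[>] 0) :=
    tendsto_nhdsWithin_iff.2 ⟨hh, by
      filter_upwards [eventually_gt_atTop 0] with n hn
      exact Real.rpow_pos_of_pos (by exact_mod_cast hn) _⟩
  have hlim : Tendsto (fun x : ℝ => 4 * (x ^ (-κ) + Real.log x / x ^ κ) + 4 * C * x ^ (-σ))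
      atTop (𝓝 0) := by
    have h := (((tendsto_rpow_neg_atTop hκ0).add
      (isLittleO_log_rpow_atTop hκ0).tendsto_div_nhds_zero).const_mul 4).add
      ((tendsto_rpow_neg_atTop hσ0).const_mul (4 * C))
    simpa using h
  obtain ⟨n, hn, h1, hbd, hnε, hn1⟩ := ((eventually_gt_atTop 0).and
    (((hlim.comp tendsto_natCast_atTop_atTop).eventually_lt_const hc0).and
      ((hh'.eventually hev).and ((hh.eventually_lt_const hε).and
        (hh.eventually_lt_const one_pos))))).exists
  have hx : (0 : ℝ) < n := by exact_mod_cast hn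
  have hx1 : (1 : ℝ) ≤ n := by exact_mod_cast hn
  simp only [Function.comp_apply] at h1
  set x : ℝ := (n : ℝ) with hxdef
  set τ := x ^ (-γ) with hτ
  have hτ0 : 0 < τ := Real.rpow_pos_of_pos hx _
  have hτ1 : τ ≤ 1 := Real.rpow_le_one_of_one_le_of_nonpos hx1 (by linarith)
  have hxτ : x * τ = x ^ (-(γ - 1)) := by
    rw [hτ, ← Real.rpow_one_add' hx.le (by linarith)]
    ring_nf
  have hmain := grid_inequality hβ hβ1 hτ0 hτ1 hn (by rw [← hxdef, hxτ]; exact hn1.le)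
    (by rw [← hxdef, hxτ]; exact hnε) (η := C * (x ^ (-(γ - 1))) ^ δ)
    (by rw [← hxdef, hxτ]; exact hbd) hneg
  rw [← hxdef, ← hc] at hmain
  -- Both losses are `x ^ 2 * τ` times the summands of `hlim`, to be compared with the gain `x ^ 2 *
  -- τ * c`.
  have e1 : x * (τ ^ β * (4 * (1 + Real.log x))) =
      x ^ 2 * τ * (4 * (x ^ (-κ) + Real.log x / x ^ κ)) := by
    have : x * τ ^ β = x ^ 2 * τ * x ^ (-κ) := by
      rw [hτ, ← Real.rpow_mul hx.le, ← Real.rpow_natCast x 2, ← Real.rpow_add hx,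
        ← Real.rpow_add hx]
      nth_rewrite 1 [← Real.rpow_one x]
      rw [← Real.rpow_add hx]
      congr 1
      rw [hκ]
      push_cast
      ring
    rw [div_eq_mul_inv, ← Real.rpow_neg hx.le]
    linear_combination (4 * (1 + Real.log x)) * this
  have e2 : 4 * x ^ 2 * (C * (x ^ (-(γ - 1))) ^ δ * τ ^ (β - 1)) =
      x ^ 2 * τ * (4 * C * x ^ (-σ)) := by
    have : (x ^ (-(γ - 1))) ^ δ * τ ^ (β - 1) = τ * x ^ (-σ) := by
      rw [hτ, ← Real.rpow_mul hx.le, ← Real.rpow_mul hx.le, ← Real.rpow_add hx,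
        ← Real.rpow_add hx]
      congr 1
      rw [hσ]
      ring
    linear_combination (4 * x ^ 2 * C) * this
  rw [e1, e2] at hmain
  have hpos : 0 < x ^ 2 * τ := by positivity
  nlinarith [mul_lt_mul_of_pos_left h1 hpos]

theorem decayExponent_le (hε : 0 < ε) [MetricSpace (Cylinder ε)] {H : ℝ} (hH : 0 < H)
    (hneg : IsNegDefKernel fun P Q : Cylinder ε => dist P Q ^ (2 * H)) :
    decayExponent ε ≤ ((3 / (2 * H) - 1 : ℝ) : EReal) := by
  refine iSup_le fun δ => iSup_le fun hδ => iSup_le fun hdev => EReal.coe_le_coe_iff.2 ?_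
  have h := exponent_mul_le hε hδ (by positivity) hdev hneg
  rw [le_sub_iff_add_le, le_div_iff₀ (by positivity)]
  linarith

/-- A real supremum is not `⊥`, so some positive exponent is admissible. -/
theorem pos_of_decayExponent_eq_coe [MetricSpace (Cylinder ε)] {δ : ℝ}
    (h : decayExponent ε = (δ : EReal)) : 0 < δ := by
  have hbot : (⊥ : EReal) < decayExponent ε := by rw [h]; exact EReal.bot_lt_coe δ
  simp only [decayExponent, lt_iSup_iff] at hbot
  obtain ⟨δ', h0, hdev, -⟩ := hbot
  have h1 : (δ' : EReal) ≤ decayExponent ε :=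
    le_iSup_of_le δ' (le_iSup_of_le h0 (le_iSup_of_le hdev le_rfl))
  rw [h, EReal.coe_le_coe_iff] at h1
  linarith

end Cylinder

theorem theorem3 (ε : ℝ) (hε : 0 < ε) [MetricSpace (Cylinder ε)] :
    (∀ δ : ℝ, Cylinder.decayExponent ε = (δ : EReal) →
      fractionalIndex (Cylinder ε) ≤ ENNReal.ofReal (3 / (δ + 1))) ∧
    (Cylinder.decayExponent ε = ⊤ → fractionalIndex (Cylinder ε) = 0) := by
  refine ⟨fun δ hδ => iSup_le fun H => iSup_le fun hH => iSup_le fun hneg => ?_, fun htop => ?_⟩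
  · have h0 := Cylinder.pos_of_decayExponent_eq_coe hδ
    have h := Cylinder.decayExponent_le hε hH hneg
    rw [hδ, EReal.coe_le_coe_iff, le_sub_iff_add_le, le_div_iff₀ (by positivity)] at h
    refine ENNReal.ofReal_le_ofReal ?_
    rw [le_div_iff₀ (by positivity)]
    linarith
  · refine le_antisymm (iSup_le fun H => iSup_le fun hH => iSup_le fun hneg => ?_) zero_le
    have h := Cylinder.decayExponent_le hε hH hneg
    rw [htop] at h
    exact absurd h (EReal.coe_lt_top _).not_ge
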